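/- Let $\mathfrak S_n$ be the set of permutations of $\{1,\dots,n\}$, written as words. For a word $x=x_1\cdots x_n$ of distinct real numbers let $\Pi(x)\in\mathfrak S_n$ be its standardization, the unique $\pi\in\mathfrak S_n$ such that $\pi_i<\pi_j$ if and only if $x_i<x_j$ for all $i,j$. A permutation $\pi\in\mathfrak S_n$ is $312$-avoiding if there are no indices $i<j<k$ with $\Pi(\pi_i\pi_j\pi_k)=312$; let $\mathfrak S_n(312)$ be the set of these permutations. Let $G(n,312)$ be the directed graph (loops and multiple edges allowed) with vertex set $\mathfrak S_n(312)$ and edge set $\mathfrak S_{n+1}(312)$, in which the edge $\sigma=\sigma_1\cdots\sigma_{n+1}$ goes from its tail $\Pi(\sigma_1\cdots\sigma_n)$ to its head $\Pi(\sigma_2\cdots\sigma_{n+1})$. A closed walk of length $d$ is a list of $d$ edges $(e_1,\dots,e_d)$ such that the head of $e_i$ is the tail of $e_{i+1}$ for $1\le i\le d-1$ and the head of $e_d$ is the tail of $e_1$; cyclic shifts of a closed walk count as different closed walks if they differ as lists, and for $d=0$ the only closed walk is the empty list. Theorem. For all integers $0\le d\le n$, the number of closed walks of length $d$ in $G(n,312)$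 is $\binom{2d}{d}$. -/

import Mathlib

namespace OverlappingPerm

/-- The standardization of a word `x` of `n` distinct letters: the permutation of `Fin n` that
sends a position `i` to the rank of the letter `x i`. (`Tuple.sort x` sends a rank to its
position.) Letters and positions are numbered from `0`. -/
def standardize {n : ℕ} {α : Type*} [LinearOrder α] (x : Fin n → α) : Equiv.Perm (Fin n) :=
  (Tuple.sort x)⁻¹

/-- The standardization of a word of distinct letters has the same relative order. -/
theorem standardize_lt_iff {n : ℕ} {α : Type*} [LinearOrder α] {x : Fin n → α}
    (hx : Function.Injective x) (i j : Fin n) :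
    standardize x i < standardize x j ↔ x i < x j := by
  have hm : StrictMono (x ∘ Tuple.sort x) :=
    (Tuple.monotone_sort x).strictMono_of_injective (hx.comp (Tuple.sort x).injective)
  have h := hm.lt_iff_lt (a := standardize x i) (b := standardize x j)
  simpa [standardize] using h.symm

/-- The standardization is the only permutation with the same relative order. -/
theorem eq_standardize {n : ℕ} {α : Type*} [LinearOrder α] {x : Fin n → α}
    (hx : Function.Injective x) (π : Equiv.Perm (Fin n))
    (h : ∀ i j, π i < π j ↔ x i < x j) : π = standardize x := by
  have hm : StrictMono (π ∘ (standardize x).symm) := by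
    intro a b hab
    have h2 := standardize_lt_iff hx ((standardize x).symm a) ((standardize x).symm b)
    simp only [Equiv.apply_symm_apply] at h2
    exact (h _ _).2 (h2.1 hab)
  have hr : Set.range (π ∘ (standardize x).symm) = Set.range (id : Fin n → Fin n) := by
    rw [(π.surjective.comp (standardize x).symm.surjective).range_eq, Set.range_id]
  have he := (StrictMono.range_inj hm strictMono_id).1 hr
  ext i
  have := congrFun he (standardize x i)
  simp only [Function.comp_apply, Equiv.symm_apply_apply, id] at this
  rw [this]

/-- `π` contains the pattern `τ`: some subword of `π` has standardization `τ`. -/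
def Contains {n k : ℕ} (π : Equiv.Perm (Fin n)) (τ : Equiv.Perm (Fin k)) : Prop :=
  ∃ ι : Fin k ↪o Fin n, standardize (π ∘ ι) = τ

/-- `π` avoids the pattern `τ`. -/
def Avoids {n k : ℕ} (π : Equiv.Perm (Fin n)) (τ : Equiv.Perm (Fin k)) : Prop :=
  ¬ Contains π τ

/-- The set of `τ`-avoiding permutations of `n` letters, as a type. -/
abbrev AvoidingPerm (n : ℕ) {k : ℕ} (τ : Equiv.Perm (Fin k)) : Type :=
  {π : Equiv.Perm (Fin n) // Avoids π τ}

/-- The pattern `312`, written with the letters `0, 1, 2`. -/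
def pattern312 : Equiv.Perm (Fin 3) where
  toFun := ![2, 0, 1]
  invFun := ![1, 2, 0]
  left_inv := by decide
  right_inv := by decide

/-- A directed graph with vertices `V` and edges `E`; loops and multiple edges are allowed. -/
structure DirectedMultigraph (V E : Type*) where
  /-- the vertex that an edge leaves -/
  tail : E → V
  /-- the vertex that an edge points to -/
  head : E → V

/-- A closed walk of length `d`: a list of `d` edges such that the head of every edge is the tail
of the cyclically next one (`finRotate d i` is `i + 1` modulo `d`). -/
def DirectedMultigraph.ClosedWalk {V E : Type*} (G : DirectedMultigraph V E) (d : ℕ) : Type _ :=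
  {e : Fin d → E // ∀ i : Fin d, G.head (e i) = G.tail (e (finRotate d i))}

/-- The graph `G(n)` of overlapping permutations: the edge `σ = σ₁ ⋯ σₙ₊₁` goes from the
standardization of `σ₁ ⋯ σₙ` to that of `σ₂ ⋯ σₙ₊₁`. -/
def overlapGraph (n : ℕ) :
    DirectedMultigraph (Equiv.Perm (Fin n)) (Equiv.Perm (Fin (n + 1))) where
  tail σ := standardize (σ ∘ Fin.castSucc)
  head σ := standardize (σ ∘ Fin.succ)

/-- The standardization of a subword of a `τ`-avoiding permutation is `τ`-avoiding. -/
theorem Avoids.standardize_comp {m n k : ℕ} {σ : Equiv.Perm (Fin m)} {τ : Equiv.Perm (Fin k)}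
    (h : Avoids σ τ) (f : Fin n ↪o Fin m) : Avoids (standardize (σ ∘ f)) τ := by
  rintro ⟨ι, hι⟩
  refine h ⟨ι.trans f, ?_⟩
  rw [← hι]
  have hf : Function.Injective (σ ∘ f) := σ.injective.comp f.injective
  have h1 : Function.Injective (standardize (σ ∘ f) ∘ ι) :=
    (standardize (σ ∘ f)).injective.comp ι.injective
  have h2 : Function.Injective (σ ∘ (ι.trans f)) := σ.injective.comp (ι.trans f).injective
  refine eq_standardize h1 _ fun i j => ?_
  rw [standardize_lt_iff h2]
  exact (standardize_lt_iff hf (ι i) (ι j)).symm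

/-- The graph `G(n, τ)` of overlapping `τ`-avoiding permutations: the subgraph of `G(n)` whose
vertices and edges are the `τ`-avoiding permutations of `n` and of `n + 1` letters. -/
def avoidingOverlapGraph (n : ℕ) {k : ℕ} (τ : Equiv.Perm (Fin k)) :
    DirectedMultigraph (AvoidingPerm n τ) (AvoidingPerm (n + 1) τ) where
  tail σ := ⟨(overlapGraph n).tail σ.1, σ.2.standardize_comp Fin.castSuccOrderEmb⟩
  head σ := ⟨(overlapGraph n).head σ.1, σ.2.standardize_comp (Fin.succOrderEmb n)⟩

end OverlappingPerm

namespace OverlappingPerm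

open Finset

/-! A closed walk is a `d`-periodic family of overlapping windows of `n + 1` letters. By
312-avoidance, those of the `n` letters before time `t` that exceed the letter at `t` form a block
ending just before `t`; the block lengths `x t` encode the walk (`exists_describes`,
`IsWalkCode.exists_walk`). The codes are those in which each interval `[t - x t, t]` with `x t < n`
contains the intervals of all its points.

Such nesting is a stack history: the letter at `t` is pushed at `t - x t` and popped at `t`, or left
uncounted if `x t = n`. The push counts have sum at most `d` and determine the code: if `x t < n`,
then `x t` is the least `u` with at least `u + 1` pushes at times `t - u, …, t` (`pushCount_injOn`).
For `d ≤ n` all `k : ZMod d → ℕ` of sum at most `d` arise, by counting records of the walk with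
steps `k - 1` (`pushCount_codeOfPush`). Stars and bars finishes. -/

/-- The permutation `σ` has no `312` pattern, spelled out in terms of its letters. -/
theorem avoids_pattern312_iff {n : ℕ} (σ : Equiv.Perm (Fin n)) :
    Avoids σ pattern312 ↔ ∀ i j k : Fin n, i < j → j < k → σ j < σ k → ¬ σ k < σ i := by
  constructor
  · intro h i j k hij hjk h1 h2
    have hm : StrictMono ![i, j, k] := by
      rw [Fin.strictMono_iff_lt_succ]
      intro a
      fin_cases a
      · exact hij
      · exact hjk
    refine h ⟨OrderEmbedding.ofStrictMono _ hm, ?_⟩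
    have hinj : Function.Injective (σ ∘ OrderEmbedding.ofStrictMono _ hm) :=
      σ.injective.comp (RelEmbedding.injective _)
    refine (eq_standardize hinj _ fun a b => ?_).symm
    have h3 : σ j < σ i := h1.trans h2
    fin_cases a <;> fin_cases b <;>
      simp [pattern312, h1, h2, h3, h1.le, h2.le, h3.le]
  · rintro h ⟨ι, hι⟩
    have hinj : Function.Injective (σ ∘ ι) := σ.injective.comp ι.injective
    have key := standardize_lt_iff hinj
    rw [hι] at key
    exact h (ι 0) (ι 1) (ι 2) (ι.strictMono (by decide)) (ι.strictMono (by decide))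
      ((key 1 2).1 (by decide)) ((key 2 0).1 (by decide))

/-- A permutation is determined by the relative order of its letters. -/
theorem perm_eq_of_lt_iff {n : ℕ} {σ τ : Equiv.Perm (Fin n)}
    (h : ∀ p q : Fin n, p < q → (σ p < σ q ↔ τ p < τ q)) : σ = τ := by
  have h' : ∀ p q : Fin n, σ p < σ q ↔ τ p < τ q := by
    intro p q
    rcases lt_trichotomy p q with hpq | rfl | hpq
    · exact h p q hpq
    · simp
    · have h1 : σ p ≠ σ q := σ.injective.ne hpq.ne'
      have h2 : τ p ≠ τ q := τ.injective.ne hpq.ne'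
      have := h q p hpq
      constructor
      · intro h3
        exact lt_of_le_of_ne (not_lt.1 fun h4 => lt_asymm h3 (this.2 h4)) h2
      · intro h3
        exact lt_of_le_of_ne (not_lt.1 fun h4 => lt_asymm h3 (this.1 h4)) h1
  rw [eq_standardize τ.injective σ h', ← eq_standardize τ.injective τ fun _ _ => Iff.rfl]

/-- Two words of distinct letters with the same relative order have the same standardization. -/
theorem standardize_eq_iff {n : ℕ} {α β : Type*} [LinearOrder α] [LinearOrder β]
    {x : Fin n → α} {y : Fin n → β} (hx : Function.Injective x) (hy : Function.Injective y) :
    standardize x = standardize y ↔ ∀ p q : Fin n, x p < x q ↔ y p < y q := by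
  constructor
  · intro h p q
    rw [← standardize_lt_iff hx, ← standardize_lt_iff hy, h]
  · intro h
    refine eq_standardize hy _ fun p q => ?_
    rw [standardize_lt_iff hx, h]

/-- In a `312`-avoiding permutation the letters before the last one that are greater than the last
one are contiguous and end just before it. -/
theorem exists_lt_last_iff {n : ℕ} {σ : Equiv.Perm (Fin (n + 1))} (hσ : Avoids σ pattern312) :
    ∃ x ≤ n, ∀ p : Fin n, σ p.castSucc < σ (Fin.last n) ↔ (p : ℕ) + x < n := by
  rw [avoids_pattern312_iff] at hσ
  classical
  let P : ℕ → Prop := fun x => x = n ∨ ∃ p : Fin n, (p : ℕ) + x + 1 = n ∧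
    σ p.castSucc < σ (Fin.last n)
  have hP : ∃ x, P x := ⟨n, Or.inl rfl⟩
  refine ⟨Nat.find hP, Nat.find_min' hP (Or.inl rfl), fun p => ⟨fun h => ?_, fun h => ?_⟩⟩
  · have := Nat.find_min' hP (m := n - 1 - p) (Or.inr ⟨p, by omega, h⟩)
    omega
  · obtain h1 | ⟨q, hq, h1⟩ := Nat.find_spec hP
    · omega
    · rcases (show p ≤ q from Fin.le_def.2 (by omega)).lt_or_eq with h2 | rfl
      · have h3 := hσ p.castSucc q.castSucc (Fin.last n) (by simpa using h2)
          (Fin.castSucc_lt_last q) h1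
        exact lt_of_le_of_ne (not_lt.1 h3) (σ.injective.ne (Fin.castSucc_lt_last p).ne)
      · exact h1

/-! ### Laminar codes of single permutations. -/

/-- The order on positions in which a later position `q` exceeds the earlier position `p` exactly
when `p` is more than `c q` steps before `q`. -/
def CodeLT (c : ℕ → ℕ) (p q : ℕ) : Prop :=
  (p < q ∧ p + c q < q) ∨ (q < p ∧ p ≤ q + c p)

/-- The intervals `[q - c q, q]` with `q ≤ n` and `c q < q` are nested or disjoint. -/
def Laminar (n : ℕ) (c : ℕ → ℕ) : Prop :=
  ∀ p q, p ≤ q → q ≤ n → q ≤ p + c q → q ≤ c q ∨ c p + q ≤ p + c q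

theorem CodeLT.trans {n : ℕ} {c : ℕ → ℕ} (hc : Laminar n c) {p q r : ℕ} (hp : p ≤ n) (hq : q ≤ n)
    (hr : r ≤ n) (h1 : CodeLT c p q) (h2 : CodeLT c q r) : CodeLT c p r := by
  have a1 := hc p q
  have a2 := hc q p
  have a3 := hc p r
  have a4 := hc r p
  have a5 := hc q r
  have a6 := hc r q
  unfold CodeLT at *
  omega

theorem CodeLT.irrefl (c : ℕ → ℕ) (p : ℕ) : ¬ CodeLT c p p := by
  unfold CodeLT
  omega

theorem CodeLT.total (c : ℕ → ℕ) {p q : ℕ} (h : p ≠ q) : CodeLT c p q ∨ CodeLT c q p := by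
  unfold CodeLT
  omega

/-- A laminar code is realized by a permutation. -/
theorem exists_perm_of_laminar {n : ℕ} {c : ℕ → ℕ} (hc : Laminar n c) :
    ∃ σ : Equiv.Perm (Fin (n + 1)), ∀ p q : Fin (n + 1), σ p < σ q ↔ CodeLT c p q := by
  classical
  let rank : Fin (n + 1) → ℕ := fun p => #{r : Fin (n + 1) | CodeLT c r p}
  have hle (p : Fin (n + 1)) : (p : ℕ) ≤ n := Nat.lt_succ_iff.1 p.2
  have hmono : ∀ p q : Fin (n + 1), CodeLT c p q → rank p < rank q := by
    intro p q h
    refine card_lt_card (ssubset_iff_of_subset ?_ |>.2 ⟨p, ?_, ?_⟩)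
    · intro r hr
      simp only [mem_filter, mem_univ, true_and] at hr ⊢
      exact hr.trans hc (hle _) (hle _) (hle _) h
    · simpa using h
    · simpa using CodeLT.irrefl c p
  have hiff : ∀ p q : Fin (n + 1), rank p < rank q ↔ CodeLT c p q := by
    refine fun p q => ⟨fun h => ?_, hmono p q⟩
    have hne : (p : ℕ) ≠ q := fun e => h.ne (by rw [Fin.ext e])
    exact (CodeLT.total c hne).resolve_right fun h' => lt_asymm h (hmono _ _ h')
  have hinj : Function.Injective rank := by
    intro p q h
    by_contra hne
    rcases CodeLT.total c (Fin.val_ne_iff.2 hne) with h' | h'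
    · exact (hmono _ _ h').ne h
    · exact (hmono _ _ h').ne' h
  exact ⟨standardize rank, fun p q => (standardize_lt_iff hinj p q).trans (hiff p q)⟩

/-- The earlier letters above a given one form a block ending just before it, so `i` above `k`
forces `j` above `k`; laminarity plays no role. -/
theorem avoids_of_codeLT {n : ℕ} {c : ℕ → ℕ} {σ : Equiv.Perm (Fin (n + 1))}
    (h : ∀ p q : Fin (n + 1), σ p < σ q ↔ CodeLT c p q) : Avoids σ pattern312 := by
  rw [avoids_pattern312_iff]
  intro i j k hij hjk
  rw [h, h]
  have h1 : (i : ℕ) < j := hij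
  have h2 : (j : ℕ) < k := hjk
  unfold CodeLT
  omega

/-! ### Closed walks and their codes. -/

/-- The codes of closed walks: `x t` is the number of letters just before time `t` that are greater
than the letter at time `t`, where only the `n` preceding letters are inspected. -/
def IsWalkCode (n : ℕ) {d : ℕ} (x : ZMod d → ℕ) : Prop :=
  ∀ t, x t ≤ n ∧ ∀ u : ℕ, u ≤ x t → x t = n ∨ x (t - u) + u ≤ x t

/-- The cyclic sequence `x` of codes describes the cyclic sequence `e` of permutations. -/
def Describes {n d : ℕ} (x : ZMod d → ℕ) (e : ZMod d → AvoidingPerm (n + 1) pattern312) : Prop :=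
  ∀ t, ∀ p q : Fin (n + 1), p < q → ((e t).1 p < (e t).1 q ↔ (p : ℕ) + x (t + (q : ℕ)) < q)

section

variable {n d : ℕ}

theorem head_eq_tail_iff (σ τ : AvoidingPerm (n + 1) pattern312) :
    (avoidingOverlapGraph n pattern312).head σ = (avoidingOverlapGraph n pattern312).tail τ ↔
      ∀ p q : Fin n, σ.1 p.succ < σ.1 q.succ ↔ τ.1 p.castSucc < τ.1 q.castSucc := by
  rw [Subtype.ext_iff]
  exact standardize_eq_iff (σ.1.injective.comp (Fin.succ_injective n))
    (τ.1.injective.comp (Fin.castSucc_injective n))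

theorem Describes.left_unique {x : ZMod d → ℕ} {e f : ZMod d → AvoidingPerm (n + 1) pattern312}
    (he : Describes x e) (hf : Describes x f) : e = f := by
  funext t
  exact Subtype.ext (perm_eq_of_lt_iff fun p q hpq => (he t p q hpq).trans (hf t p q hpq).symm)

theorem Describes.right_unique {x y : ZMod d → ℕ}
    {e : ZMod d → AvoidingPerm (n + 1) pattern312} (hx : Describes x e) (hy : Describes y e)
    (hxn : ∀ t, x t ≤ n) (hyn : ∀ t, y t ≤ n) : x = y := by
  funext t
  have key : ∀ p : Fin n, (p : ℕ) + x t < n ↔ (p : ℕ) + y t < n := by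
    intro p
    have h1 := hx (t - n) p.castSucc (Fin.last n) (Fin.castSucc_lt_last p)
    have h2 := hy (t - n) p.castSucc (Fin.last n) (Fin.castSucc_lt_last p)
    simp only [Fin.val_last, sub_add_cancel, Fin.val_castSucc] at h1 h2
    rw [← h1, ← h2]
  have hxt := hxn t
  have hyt := hyn t
  rcases lt_trichotomy (x t) (y t) with h | h | h
  -- The position just before the shorter block separates the two codes.
  · have := key ⟨n - 1 - x t, by omega⟩
    simp only at this
    omega
  · exact h
  · have := key ⟨n - 1 - y t, by omega⟩
    simp only at this
    omega

/-- Every closed walk has a code. -/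
theorem exists_describes {e : ZMod d → AvoidingPerm (n + 1) pattern312}
    (he : ∀ t, (avoidingOverlapGraph n pattern312).head (e t) =
      (avoidingOverlapGraph n pattern312).tail (e (t + 1))) :
    ∃ x : ZMod d → ℕ, IsWalkCode n x ∧ Describes x e := by
  choose y hyn hy using fun t => exists_lt_last_iff (e t).2
  let x : ZMod d → ℕ := fun t => y (t - n)
  have hx : Describes x e := by
    -- Induction on `n - q`: in the window one step earlier, `q` becomes `q + 1`, until it is the
    -- last position.
    suffices H : ∀ m, ∀ t, ∀ p q : Fin (n + 1), (q : ℕ) + m = n → p < q →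
        ((e t).1 p < (e t).1 q ↔ (p : ℕ) + x (t + (q : ℕ)) < q) from
      fun t p q hpq => H (n - q) t p q (by omega) hpq
    intro m
    induction m with
    | zero =>
      intro t p q hq hpq
      obtain rfl : q = Fin.last n := Fin.ext (by simpa using hq)
      have := hy t (p.castPred hpq.ne)
      simpa [x] using this
    | succ m ih =>
      intro t p q hq hpq
      have hpq' : (p : ℕ) < q := hpq
      have h := (head_eq_tail_iff _ _).1 (he (t - 1)) ⟨p, by omega⟩ ⟨q, by omega⟩
      rw [sub_add_cancel] at h
      have h2 := ih (t - 1) (Fin.succ ⟨p, by omega⟩) (Fin.succ ⟨q, by omega⟩)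
        (by simp; omega) (by simpa using hpq)
      rw [h] at h2
      refine h2.trans ?_
      have : t - 1 + ((q : ℕ) + 1 : ℕ) = t + (q : ℕ) := by push_cast; ring
      simp only [Fin.val_succ, this]
      omega
  refine ⟨x, fun t => ⟨hyn _, fun u hu => ?_⟩, hx⟩
  have hxn : x t ≤ n := hyn _
  by_contra! hcon
  obtain ⟨h1, h2⟩ := hcon
  have hu0 : u ≠ 0 := by
    rintro rfl
    simp at h2
  -- Position `n - 1 - x t` holds the nearest letter below the last one. It is then also below the
  -- letter at `n - u`, whose block must stop after it.
  have hlast := hx (t - n) ⟨n - 1 - x t, by omega⟩ (Fin.last n) (Fin.lt_def.2 (by simp; omega))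
  have hmid := hx (t - n) ⟨n - u, by omega⟩ (Fin.last n) (Fin.lt_def.2 (by simp; omega))
  have hlow := hx (t - n) ⟨n - 1 - x t, by omega⟩ ⟨n - u, by omega⟩ (Fin.lt_def.2 (by simp; omega))
  have hcast : t - n + ((n - u : ℕ) : ZMod d) = t - u := by
    rw [Nat.cast_sub (by omega)]
    ring
  simp only [Fin.val_last, sub_add_cancel, hcast] at hlast hmid hlow
  have h3 := hlow.1 ((hlast.2 (by omega)).trans_le (not_lt.1 fun h => by have := hmid.1 h; omega))
  omega

/-- Every code comes from a closed walk. -/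
theorem IsWalkCode.exists_walk {x : ZMod d → ℕ} (hx : IsWalkCode n x) :
    ∃ e : ZMod d → AvoidingPerm (n + 1) pattern312,
      (∀ t, (avoidingOverlapGraph n pattern312).head (e t) =
        (avoidingOverlapGraph n pattern312).tail (e (t + 1))) ∧ Describes x e := by
  have hlam : ∀ t, Laminar n fun q => x (t + q) := by
    intro t p q hpq hq h
    obtain h1 | h1 := (hx (t + q)).2 (q - p) (by simp only at h; omega)
    · left
      simp only [h1]
      exact hq
    · right
      have : t + q - ((q - p : ℕ) : ZMod d) = t + p := by
        rw [Nat.cast_sub hpq]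
        ring
      rw [this] at h1
      simp only
      omega
  choose σ hσ using fun t => exists_perm_of_laminar (hlam t)
  refine ⟨fun t => ⟨σ t, avoids_of_codeLT (hσ t)⟩, fun t => ?_, fun t p q hpq => ?_⟩
  · rw [head_eq_tail_iff]
    intro p q
    simp only [hσ, CodeLT, Fin.val_succ, Fin.val_castSucc, Nat.cast_add, Nat.cast_one]
    have h1 : t + ((q : ℕ) + 1) = t + 1 + (q : ℕ) := by ring
    have h2 : t + ((p : ℕ) + 1) = t + 1 + (p : ℕ) := by ring
    rw [h1, h2]
    omega
  · have hpq' : (p : ℕ) < q := hpq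
    simp only [hσ, CodeLT]
    omega

/-- Closed walks are in bijection with their codes. -/
theorem card_closedWalk_eq (n m : ℕ) :
    Nat.card ((avoidingOverlapGraph n pattern312).ClosedWalk (m + 1)) =
      Nat.card {x : ZMod (m + 1) → ℕ // IsWalkCode n x} := by
  let W := {e : ZMod (m + 1) → AvoidingPerm (n + 1) pattern312 //
    ∀ t, (avoidingOverlapGraph n pattern312).head (e t) =
      (avoidingOverlapGraph n pattern312).tail (e (t + 1))}
  have h1 : Nat.card ((avoidingOverlapGraph n pattern312).ClosedWalk (m + 1)) = Nat.card W := by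
    -- `ZMod (m + 1)` unfolds to `Fin (m + 1)`, so only the successor map needs rewriting.
    refine Nat.card_congr (Equiv.subtypeEquivRight fun e => forall_congr' fun t => ?_)
    rw [finRotate_apply]
    rfl
  rw [h1]
  choose f hf hf' using fun e : W => exists_describes e.2
  refine Nat.card_congr (Equiv.ofBijective (fun e => ⟨f e, hf e⟩) ⟨fun a b hab => ?_, fun x => ?_⟩)
  · have hfab : f a = f b := congrArg Subtype.val hab
    exact Subtype.ext ((hf' a).left_unique (hfab ▸ hf' b))
  · obtain ⟨e, he, hd⟩ := x.2.exists_walk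
    exact ⟨⟨e, he⟩, Subtype.ext ((hf' ⟨e, he⟩).right_unique hd (fun t => (hf _ t).1)
      fun t => (x.2 t).1)⟩

end

/-! ### Stars and bars. -/

theorem card_sum_le_eq_choose (d : ℕ) [NeZero d] :
    Nat.card {k : ZMod d → ℕ // ∑ t, k t ≤ d} = (2 * d).choose d := by
  classical
  -- The coordinate `none` is a slack variable.
  have e : {k : ZMod d → ℕ // ∑ t, k t ≤ d} ≃ {k : Option (ZMod d) → ℕ // ∑ t, k t = d} :=
    { toFun := fun k => ⟨fun o => o.elim (d - ∑ t, k.1 t) k.1, by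
        have := k.2
        rw [Fintype.sum_option]
        simp only [Option.elim]
        omega⟩
      invFun := fun k => ⟨fun t => k.1 (some t), by
        have := k.2
        rw [Fintype.sum_option] at this
        exact le_of_add_le_right this.le⟩
      left_inv := fun k => rfl
      right_inv := fun k => by
        have := k.2
        rw [Fintype.sum_option] at this
        ext o
        cases o with
        | none => simp only [Option.elim]; omega
        | some t => rfl }
  rw [Nat.card_congr (e.trans (Sym.equivNatSumOfFintype (Option (ZMod d)) d).symm),
    Nat.card_eq_fintype_card, Sym.card_sym_eq_choose, Fintype.card_option, ZMod.card]
  congr 1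
  omega

/-! ### Push counts determine the code. -/

section

variable {n d : ℕ}

/-- The number of letters that are pushed at time `t`, in the description of `312`-avoiding words
by a stack: the letter at time `v` is pushed `x v` steps before it is popped. -/
def pushCount [NeZero d] (n : ℕ) (x : ZMod d → ℕ) (t : ZMod d) : ℕ :=
  #{v : ZMod d | x v < n ∧ v - (x v : ℕ) = t}

theorem sum_pushCount_le [NeZero d] (n : ℕ) (x : ZMod d → ℕ) : ∑ t, pushCount n x t ≤ d := by
  classical
  have h : ∀ t, pushCount n x t =
      #{v ∈ ({v : ZMod d | x v < n} : Finset _) | v - (x v : ℕ) = t} := by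
    intro t
    rw [filter_filter]
    rfl
  simp only [h]
  rw [← card_eq_sum_card_fiberwise fun _ _ => mem_coe.2 (mem_univ _)]
  exact (card_le_univ _).trans_eq (ZMod.card d)

theorem cast_injOn_range : Set.InjOn (fun s : ℕ => (s : ZMod d)) (range d : Set ℕ) := by
  intro a ha b hb h
  have := (ZMod.natCast_eq_natCast_iff' a b d).1 h
  rwa [Nat.mod_eq_of_lt (by simpa using ha), Nat.mod_eq_of_lt (by simpa using hb)] at this

theorem IsWalkCode.lt_period [NeZero d] {x : ZMod d → ℕ} (hx : IsWalkCode n x) {t : ZMod d} (h : x t < n) :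
    x t < d := by
  by_contra! hd
  have h1 := (hx t).2 d hd
  rw [ZMod.natCast_self, sub_zero] at h1
  have := NeZero.pos d
  omega

/-- A sum of push counts over an interval of times counts the letters that are pushed then. -/
theorem sum_pushCount_eq [NeZero d] (x : ZMod d → ℕ) (t : ZMod d) {u : ℕ} (hu : u < d) :
    ∑ s ∈ range (u + 1), pushCount n x (t - (s : ℕ)) =
      #{v : ZMod d | x v < n ∧ ∃ s ≤ u, v - (x v : ℕ) = t - (s : ℕ)} := by
  classical
  have hinj : Set.InjOn (fun s : ℕ => t - (s : ZMod d)) (range (u + 1) : Set ℕ) := by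
    intro a ha b hb h
    simp only [coe_range, Set.mem_Iio] at ha hb
    exact cast_injOn_range (by simp; omega) (by simp; omega) (sub_right_injective h)
  rw [← sum_image (f := pushCount n x) hinj]
  have h : ∀ t', pushCount n x t' =
      #{v ∈ ({v : ZMod d | x v < n} : Finset _) | v - (x v : ℕ) = t'} := by
    intro t'
    rw [filter_filter]
    rfl
  simp only [h]
  rw [sum_card_fiberwise_eq_card_filter, filter_filter]
  congr 1
  ext v
  simp only [mem_filter, mem_univ, true_and, mem_image, mem_range, Nat.lt_succ_iff]
  refine and_congr_right fun _ => ?_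
  exact exists_congr fun s => and_congr_right fun _ => eq_comm

/-- By nesting, all `x t + 1` letters in `[t - x t, t]` are pushed within that interval. -/
theorem IsWalkCode.le_sum_pushCount [NeZero d] {x : ZMod d → ℕ} (hx : IsWalkCode n x) {t : ZMod d}
    (h : x t < n) : x t + 1 ≤ ∑ s ∈ range (x t + 1), pushCount n x (t - (s : ℕ)) := by
  classical
  have hd := hx.lt_period h
  rw [sum_pushCount_eq x t hd]
  have hinj : Set.InjOn (fun s : ℕ => t - (s : ZMod d)) (range (x t + 1) : Set ℕ) := by
    intro a ha b hb h
    simp only [coe_range, Set.mem_Iio] at ha hb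
    exact cast_injOn_range (by simp; omega) (by simp; omega) (sub_right_injective h)
  conv_lhs => rw [← card_range (x t + 1), ← card_image_of_injOn hinj]
  refine card_le_card fun v hv => ?_
  obtain ⟨s, hs, rfl⟩ := mem_image.1 hv
  have hs' : s ≤ x t := by simpa [Nat.lt_succ_iff] using hs
  have h1 := ((hx t).2 s hs').resolve_left h.ne
  refine mem_filter.2 ⟨mem_univ _, by omega, s + x (t - s), by omega, ?_⟩
  push_cast
  ring

/-- A letter pushed in `[t - u, t]` is popped before `t`: otherwise its interval contains `t`, hence
`[t - x t, t]`, which starts too early. This leaves only `u` pop times. -/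
theorem IsWalkCode.sum_pushCount_le [NeZero d] {x : ZMod d → ℕ} (hx : IsWalkCode n x) {t : ZMod d} {u : ℕ}
    (hu : u < x t) (hd : u < d) : ∑ s ∈ range (u + 1), pushCount n x (t - (s : ℕ)) ≤ u := by
  classical
  rw [sum_pushCount_eq x t hd]
  have hsub : ({v : ZMod d | x v < n ∧ ∃ s ≤ u, v - (x v : ℕ) = t - (s : ℕ)} : Finset _) ⊆
      (Icc 1 u).image fun s : ℕ => t - (s : ZMod d) := by
    intro v hv
    obtain ⟨hv, s, hs, h⟩ := (mem_filter.1 hv).2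
    have hlt : x v < s := by
      by_contra! hle
      have h1 := ((hx v).2 (x v - s) (by omega)).resolve_left hv.ne
      have h2 : v - ((x v - s : ℕ) : ZMod d) = t := by
        rw [Nat.cast_sub hle]
        linear_combination h
      rw [h2] at h1
      omega
    refine mem_image.2 ⟨s - x v, mem_Icc.2 (by omega), ?_⟩
    rw [Nat.cast_sub hlt.le]
    linear_combination -h
  refine (card_le_card hsub).trans (card_image_le.trans ?_)
  simp

theorem pushCount_injOn [NeZero d] {x y : ZMod d → ℕ} (hx : IsWalkCode n x)
    (hy : IsWalkCode n y) (h : pushCount n x = pushCount n y) : x = y := by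
  have key : ∀ {x y : ZMod d → ℕ}, IsWalkCode n x → IsWalkCode n y →
      pushCount n x = pushCount n y → ∀ t, y t ≤ x t := by
    intro x y hx hy h t
    by_contra! hlt
    have hn := (hy t).1
    have h1 := hx.le_sum_pushCount (t := t) (by omega)
    have h2 := hy.sum_pushCount_le hlt (hx.lt_period (by omega))
    rw [h] at h1
    omega
  exact funext fun t => le_antisymm (key hy hx h.symm t) (key hx hy h t)

/-! ### Recovering the code from the push counts. -/

/-- At time `t`, the letter that was pushed `u` steps earlier can be popped: at least as many
letters were pushed as were popped since. -/
def Reaches (k : ZMod d → ℕ) (t : ZMod d) (u : ℕ) : Prop :=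
  u + 1 ≤ ∑ s ∈ range (u + 1), k (t - (s : ℕ))

theorem sum_range_shift (k : ZMod d → ℕ) (t : ZMod d) (a b : ℕ) :
    ∑ s ∈ range (a + b), k (t - (s : ℕ)) =
      ∑ s ∈ range a, k (t - (s : ℕ)) + ∑ s ∈ range b, k (t - (a : ℕ) - (s : ℕ)) := by
  rw [sum_range_add]
  congr 1
  refine sum_congr rfl fun s _ => ?_
  congr 1
  push_cast
  ring

open Classical in
/-- The code of the closed walk with the push counts `k`. -/
noncomputable def codeOfPush (n : ℕ) (k : ZMod d → ℕ) (t : ZMod d) : ℕ :=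
  if h : ∃ u, u < d ∧ Reaches k t u then Nat.find h else n

theorem codeOfPush_le {k : ZMod d → ℕ} {t : ZMod d} {u : ℕ} (hu : u < d) (h : Reaches k t u) :
    codeOfPush n k t ≤ u := by
  classical
  have hex : ∃ u, u < d ∧ Reaches k t u := ⟨u, hu, h⟩
  rw [codeOfPush, dif_pos hex]
  exact Nat.find_min' hex ⟨hu, h⟩

theorem codeOfPush_spec {k : ZMod d → ℕ} {t : ZMod d} (h : codeOfPush n k t ≠ n) :
    codeOfPush n k t < d ∧ Reaches k t (codeOfPush n k t) := by
  classical
  by_cases hex : ∃ u, u < d ∧ Reaches k t u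
  · rw [codeOfPush, dif_pos hex]
    exact Nat.find_spec hex
  · rw [codeOfPush, dif_neg hex] at h
    exact absurd rfl h

theorem isWalkCode_codeOfPush (hdn : d ≤ n) (k : ZMod d → ℕ) :
    IsWalkCode n (codeOfPush n k) := by
  intro t
  by_cases h : codeOfPush n k t = n
  · exact ⟨h.le, fun _ _ => Or.inl h⟩
  obtain ⟨h1, h2⟩ := codeOfPush_spec h
  refine ⟨by omega, fun u hu => Or.inr ?_⟩
  rcases Nat.eq_zero_or_pos u with rfl | hpos
  · simp
  -- Minimality: the last `u` times carry fewer than `u` pushes, so the earlier ones have enough for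
  -- `t - u` to reach within the interval.
  have h3 : ¬ Reaches k t (u - 1) := fun h3 => by
    have := codeOfPush_le (n := n) (by omega) h3
    omega
  unfold Reaches at h2 h3
  rw [show u - 1 + 1 = u by omega] at h3
  rw [show codeOfPush n k t + 1 = u + (codeOfPush n k t - u + 1) by omega,
    sum_range_shift] at h2
  have h4 : codeOfPush n k (t - u) ≤ codeOfPush n k t - u :=
    codeOfPush_le (by omega) (by unfold Reaches; omega)
  omega

/-- Among the values of a walk on the integers whose steps down have size at most one, those at
least `0` that are attained as strict minima of the past are `0, …, F 0`. -/
theorem card_records (F : ℕ → ℤ) (m : ℕ) (hstep : ∀ i < m, F i ≤ F (i + 1) + 1)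
    (h0 : -1 ≤ F 0) (hm : F m ≤ 0) :
    #{i ∈ range (m + 1) | 0 ≤ F i ∧ ∀ j < i, F i < F j} = (F 0 + 1).toNat := by
  rw [← card_range (F 0 + 1).toNat]
  refine card_bij (fun i _ => (F i).toNat) ?_ ?_ ?_
  · intro i hi
    simp only [mem_filter, mem_range] at hi ⊢
    have : F i ≤ F 0 := by
      rcases Nat.eq_zero_or_pos i with rfl | hpos
      · exact le_rfl
      · exact (hi.2.2 0 hpos).le
    omega
  · intro i hi j hj h
    simp only [mem_filter, mem_range] at hi hj
    rcases lt_trichotomy i j with hij | hij | hij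
    · have := hj.2.2 i hij
      omega
    · exact hij
    · have := hi.2.2 j hij
      omega
  · intro b hb
    rw [mem_range] at hb
    have hex : ∃ i, F i ≤ b := ⟨m, by omega⟩
    have hspec := Nat.find_spec hex
    have hle : Nat.find hex ≤ m := Nat.find_min' hex (by omega)
    have hmin : ∀ j < Nat.find hex, (b : ℤ) < F j := fun j hj => not_le.1 (Nat.find_min hex hj)
    have heq : F (Nat.find hex) = b := by
      refine le_antisymm hspec ?_
      rcases Nat.eq_zero_or_pos (Nat.find hex) with hz | hpos
      · rw [hz]
        omega
      · have h1 := hmin (Nat.find hex - 1) (by omega)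
        have h2 := hstep (Nat.find hex - 1) (by omega)
        rw [Nat.sub_add_cancel hpos] at h2
        omega
    refine ⟨Nat.find hex, ?_, by rw [heq]; simp⟩
    simp only [mem_filter, mem_range]
    exact ⟨by omega, by omega, fun j hj => heq.trans_lt (hmin j hj)⟩

/-- The number of letters that are pushed minus the number of those popped from time `t` on. -/
def balance (k : ZMod d → ℕ) (t : ZMod d) (i : ℕ) : ℤ :=
  ∑ s ∈ range (i + 1), ((k (t + (s : ℕ)) : ℤ) - 1)

theorem balance_eq (k : ZMod d → ℕ) (t : ZMod d) (i : ℕ) :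
    balance k t i = ((∑ s ∈ range (i + 1), k (t + (i : ℕ) - (s : ℕ)) : ℕ) : ℤ) - (i + 1) := by
  rw [balance, sum_sub_distrib, ← sum_range_reflect]
  simp only [sum_const, card_range, nsmul_eq_mul, mul_one, Nat.cast_sum]
  push_cast
  congr 1
  refine sum_congr rfl fun s hs => ?_
  rw [mem_range] at hs
  congr 2
  rw [Nat.cast_sub (by omega)]
  ring

theorem codeOfPush_add_eq_iff (hdn : d ≤ n) (k : ZMod d → ℕ) (t : ZMod d) {i : ℕ} (hi : i < d) :
    codeOfPush n k (t + (i : ℕ)) = i ↔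
      0 ≤ balance k t i ∧ ∀ j < i, balance k t i < balance k t j := by
  have hreach : Reaches k (t + (i : ℕ)) i ↔ 0 ≤ balance k t i := by
    rw [balance_eq, Reaches]
    omega
  -- The times involved are `j + 1, …, i`, whose net contribution is the difference of the two
  -- balances.
  have hnot : ∀ j < i, (Reaches k (t + (i : ℕ)) (i - 1 - j) ↔ balance k t j ≤ balance k t i) := by
    intro j hj
    have h := sum_range_shift k (t + (i : ℕ)) (i - 1 - j + 1) (j + 1)
    rw [show i - 1 - j + 1 + (j + 1) = i + 1 by omega,
      show t + (i : ℕ) - ((i - 1 - j + 1 : ℕ) : ZMod d) = t + (j : ℕ) by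
        rw [show i - 1 - j + 1 = i - j by omega, Nat.cast_sub hj.le]; ring] at h
    rw [balance_eq, balance_eq, h, Reaches, Nat.cast_add]
    omega
  constructor
  · intro h
    have hs := codeOfPush_spec (n := n) (k := k) (t := t + (i : ℕ)) (by omega)
    rw [h] at hs
    refine ⟨hreach.1 hs.2, fun j hj => ?_⟩
    by_contra! hle
    have := codeOfPush_le (n := n) (by omega) ((hnot j hj).2 hle)
    omega
  · rintro ⟨h0, h1⟩
    have hle := codeOfPush_le (n := n) hi (hreach.2 h0)
    refine le_antisymm hle ?_
    by_contra! hlt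
    have hs := codeOfPush_spec (n := n) (k := k) (t := t + (i : ℕ)) (by omega)
    have h2 := h1 (i - 1 - codeOfPush n k (t + (i : ℕ))) (by omega)
    have h3 := (hnot (i - 1 - codeOfPush n k (t + (i : ℕ))) (by omega)).1 (by
      rw [show i - 1 - (i - 1 - codeOfPush n k (t + (i : ℕ))) = codeOfPush n k (t + (i : ℕ)) by
        omega]
      exact hs.2)
    omega

theorem sum_range_add_cast [NeZero d] (k : ZMod d → ℤ) (t : ZMod d) :
    ∑ s ∈ range d, k (t + (s : ℕ)) = ∑ v, k v := by
  refine sum_bij (fun s _ => t + (s : ZMod d)) (fun _ _ => mem_univ _) ?_ ?_ fun _ _ => rfl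
  · intro a ha b hb h
    exact cast_injOn_range (mem_coe.2 ha) (mem_coe.2 hb) (add_left_cancel h)
  · intro v _
    exact ⟨(v - t).val, mem_range.2 (ZMod.val_lt _), by simp⟩

/-- Letters pushed at `t` correspond to nonnegative records of the balance from `t`. It starts at `k
t - 1`, drops by at most one per step and ends at `∑ k - d ≤ 0`, so there are `k t` of them. -/
theorem pushCount_codeOfPush [NeZero d] (hdn : d ≤ n) {k : ZMod d → ℕ} (hk : ∑ t, k t ≤ d) :
    pushCount n (codeOfPush n k) = k := by
  classical
  have hd := NeZero.pos d
  funext t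
  have hrec := card_records (balance k t) (d - 1) (fun i _ => by
      rw [balance, balance, sum_range_succ _ (i + 1)]
      omega) (by simp only [balance, zero_add, range_one, sum_singleton]; omega) (by
      rw [balance, Nat.sub_add_cancel hd, sum_range_add_cast (fun v => (k v : ℤ) - 1)]
      simp only [sum_sub_distrib, sum_const, card_univ, ZMod.card, nsmul_eq_mul, mul_one]
      rw [← Nat.cast_sum]
      omega)
  have h0 : (balance k t 0 + 1).toNat = k t := by simp [balance]
  rw [h0, Nat.sub_add_cancel hd] at hrec
  rw [← hrec, pushCount]
  symm
  refine card_bij (fun i _ => t + (i : ZMod d)) ?_ ?_ ?_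
  · intro i hi
    obtain ⟨hi, h⟩ := mem_filter.1 hi
    rw [mem_range] at hi
    have := (codeOfPush_add_eq_iff hdn k t hi).2 h
    exact mem_filter.2 ⟨mem_univ _, by omega, by rw [this]; ring⟩
  · intro a ha b hb h
    exact cast_injOn_range (mem_coe.2 (mem_filter.1 ha).1) (mem_coe.2 (mem_filter.1 hb).1)
      (add_left_cancel h)
  · intro v hv
    obtain ⟨h1, h2⟩ := (mem_filter.1 hv).2
    have h3 := (codeOfPush_spec h1.ne).1
    have h4 : v = t + (codeOfPush n k v : ℕ) := by rw [← h2]; ring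
    refine ⟨codeOfPush n k v, mem_filter.2 ⟨mem_range.2 h3, ?_⟩, h4.symm⟩
    rw [← codeOfPush_add_eq_iff hdn k t h3, ← h4]

theorem card_isWalkCode [NeZero d] (hdn : d ≤ n) :
    Nat.card {x : ZMod d → ℕ // IsWalkCode n x} = (2 * d).choose d := by
  rw [← card_sum_le_eq_choose]
  refine Nat.card_congr (Equiv.ofBijective
    (fun x => ⟨pushCount n x.1, sum_pushCount_le n x.1⟩) ⟨fun x y h => ?_, fun k => ?_⟩)
  · exact Subtype.ext (pushCount_injOn x.2 y.2 (congrArg Subtype.val h))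
  · exact ⟨⟨codeOfPush n k.1, isWalkCode_codeOfPush hdn k.1⟩,
      Subtype.ext (pushCount_codeOfPush hdn k.2)⟩

end

end OverlappingPerm

theorem theorem5p1 (n d : ℕ) (hd : d ≤ n) :
    Nat.card ((OverlappingPerm.avoidingOverlapGraph n OverlappingPerm.pattern312).ClosedWalk d) =
      Nat.choose (2 * d) d := by
  cases d with
  -- Treated apart because `ZMod 0` is `ℤ`, not an empty set of times.
  | zero =>
    rw [Nat.choose_self, Nat.card_eq_one_iff_unique]
    exact ⟨⟨fun _ _ => Subtype.ext (Subsingleton.elim _ _)⟩, ⟨Fin.elim0, fun i => i.elim0⟩⟩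
  | succ m => rw [OverlappingPerm.card_closedWalk_eq, OverlappingPerm.card_isWalkCode hd]
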